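/- Theorem 1. Let $\mathbb R^3_1$ be Lorentz–Minkowski 3-space with coordinates $(t,x,y)$ and inner product $-dt^2+dx^2+dy^2$. There exists a mixed-type entire zero-mean-curvature graph of type S (that is, a real-analytic graph over a whole space-like plane, whose mean curvature vanishes wherever the induced metric is non-degenerate, and which has both space-like and time-like points) which is not a Kobayashi surface. More precisely, the graph of $$t=\operatorname{arcsinh}(e^{y}\cos x),\qquad (x,y)\in\mathbb R^2,$$ is a mixed-type entire zero-mean-curvature graph; its space-like part is connected, its time-like part has infinitely many connected components, it has no umbilics, and it is not a Kobayashi surface. Here a Kobayashi surface of order $n\ge 2$ is a connected real-analytic surface in $\mathbb R^3_1$ which, up to isometries and homotheties of $\mathbb R^3_1$, is an analytic extension of a maxface $$f=\operatorname{Re}\int\bigl(-2g,\ 1+g^2,\ i(1-g^2)\bigr)\,\omega ,\qquad g=\prod_{i=1}^{n-1}\frac{z-b_i}{1-\bar b_i z},\qquad \omega=\frac{i\prod_{i=1}^{n-1}(1-\bar b_i z)^2}{\prod_{j=0}^{2n-1}\bigl(e^{-i\alpha_j/2}z-e^{i\alpha_j/2}\bigr)}\,dz,$$ defined on the Riemann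 sphere without the points $e^{i\alpha_j}$, where $b_1,\dots,b_{n-1}\in\mathbb C$ satisfy $|b_i|<1$ and $\alpha_0,\dots,\alpha_{2n-1}\in\mathbb R$ are not necessarily distinct. A Kobayashi surface is a Kobayashi surface of some order $n\ge 2$. -/

import Mathlib

/-- Lorentz-Minkowski 3-space, with coordinates `(t, x, y)`. -/
abbrev R31 : Type := ℝ × ℝ × ℝ

/-- The Lorentzian inner product, of signature `(-, +, +)`. -/
def lorentz (u v : R31) : ℝ := -(u.1 * v.1) + u.2.1 * v.2.1 + u.2.2 * v.2.2

/-- The Lorentzian cross product: `lorentz (lorentzCross u v) w = det (u, v, w)`. -/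
def lorentzCross (u v : R31) : R31 :=
  (-(u.2.1 * v.2.2 - u.2.2 * v.2.1), u.2.2 * v.1 - u.1 * v.2.2, u.1 * v.2.1 - u.2.1 * v.1)

section Surfaces

/-- First partial derivatives of a parametrized surface. -/
noncomputable def partialX (F : ℝ × ℝ → R31) (p : ℝ × ℝ) : R31 := fderiv ℝ F p (1, 0)

noncomputable def partialY (F : ℝ × ℝ → R31) (p : ℝ × ℝ) : R31 := fderiv ℝ F p (0, 1)

/-- Coefficients of the first fundamental form. -/
noncomputable def firstE (F : ℝ × ℝ → R31) (p : ℝ × ℝ) : ℝ :=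
  lorentz (partialX F p) (partialX F p)

noncomputable def firstF (F : ℝ × ℝ → R31) (p : ℝ × ℝ) : ℝ :=
  lorentz (partialX F p) (partialY F p)

noncomputable def firstG (F : ℝ × ℝ → R31) (p : ℝ × ℝ) : ℝ :=
  lorentz (partialY F p) (partialY F p)

/-- Determinant of the first fundamental form. -/
noncomputable def metricDet (F : ℝ × ℝ → R31) (p : ℝ × ℝ) : ℝ :=
  firstE F p * firstG F p - firstF F p ^ 2

/-- The unit normal vector, meaningful where the first fundamental form is non-degenerate. -/
noncomputable def unitNormal (F : ℝ × ℝ → R31) (p : ℝ × ℝ) : R31 :=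
  (√|lorentz (lorentzCross (partialX F p) (partialY F p))
      (lorentzCross (partialX F p) (partialY F p))|)⁻¹ •
    lorentzCross (partialX F p) (partialY F p)

/-- Coefficients of the second fundamental form. -/
noncomputable def secondL (F : ℝ × ℝ → R31) (p : ℝ × ℝ) : ℝ :=
  lorentz (partialX (partialX F) p) (unitNormal F p)

noncomputable def secondM (F : ℝ × ℝ → R31) (p : ℝ × ℝ) : ℝ :=
  lorentz (partialX (partialY F) p) (unitNormal F p)

noncomputable def secondN (F : ℝ × ℝ → R31) (p : ℝ × ℝ) : ℝ :=
  lorentz (partialY (partialY F) p) (unitNormal F p)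

/-- The mean curvature (up to the sign given by the choice of the normal), meaningful where the
first fundamental form is non-degenerate. -/
noncomputable def meanCurvature (F : ℝ × ℝ → R31) (p : ℝ × ℝ) : ℝ :=
  (firstG F p * secondL F p - 2 * (firstF F p * secondM F p) + firstE F p * secondN F p) /
    (2 * metricDet F p)

/-- Parameters of the space-like points: the induced metric is positive definite. (A tangent plane
in a space of signature `(-, +, +)` is never negative definite, so that a positive determinant
means positive definite.) -/
def spacelikeSet (F : ℝ × ℝ → R31) : Set (ℝ × ℝ) := {p | 0 < metricDet F p}

/-- Parameters of the time-like points: the induced metric is Lorentzian. -/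
def timelikeSet (F : ℝ × ℝ → R31) : Set (ℝ × ℝ) := {p | metricDet F p < 0}

/-- Umbilics: non-degenerate points at which the second fundamental form is proportional to the
first one. -/
def IsUmbilic (F : ℝ × ℝ → R31) (p : ℝ × ℝ) : Prop :=
  metricDet F p ≠ 0 ∧ ∃ k : ℝ,
    secondL F p = k * firstE F p ∧ secondM F p = k * firstF F p ∧ secondN F p = k * firstG F p

/-- The connected components of a planar set. -/
def componentsOf (A : Set (ℝ × ℝ)) : Set (Set (ℝ × ℝ)) :=
  {C | ∃ p ∈ A, C = connectedComponentIn A p}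

/-- The graph `t = h (x, y)` over the space-like `xy`-plane, as a parametrized surface. -/
def graphMap (h : ℝ × ℝ → ℝ) (p : ℝ × ℝ) : R31 := (h p, p.1, p.2)

/-- Entire zero-mean-curvature graphs of type S: real-analytic graphs `t = h (x, y)` over the whole
space-like `xy`-plane (every space-like plane is congruent to it) whose mean curvature vanishes
wherever it is defined. -/
structure IsEntireZMCGraphTypeS (h : ℝ × ℝ → ℝ) : Prop where
  analytic : AnalyticOnNhd ℝ h Set.univ
  zmc : ∀ p, metricDet (graphMap h) p ≠ 0 → meanCurvature (graphMap h) p = 0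

/-- Mixed type: there are both space-like and time-like points. -/
def IsMixedType (F : ℝ × ℝ → R31) : Prop :=
  (spacelikeSet F).Nonempty ∧ (timelikeSet F).Nonempty

end Surfaces

section Kobayashi

/-- Parameters of a Kobayashi surface of order `n`: `n - 1` points of the open unit disc, and `2n`
not necessarily distinct angles. (Normalizing the angles by `0 = α₀ ≤ α₁ ≤ … < 2π` gives the same
surfaces up to congruence.) -/
structure KobayashiData (n : ℕ) where
  b : Fin (n - 1) → ℂ
  norm_b_lt : ∀ i, ‖b i‖ < 1
  angle : Fin (2 * n) → ℝ

namespace KobayashiData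

variable {n : ℕ} (D : KobayashiData n)

/-- The Gauss map `g = ∏ (z - bᵢ) / (1 - b̄ᵢ z)`. -/
noncomputable def gauss (z : ℂ) : ℂ :=
  ∏ i, (z - D.b i) / (1 - (starRingEnd ℂ) (D.b i) * z)

/-- The coefficient of `ω = i ∏ (1 - b̄ᵢ z)² / ∏ (e^{-i αⱼ/2} z - e^{i αⱼ/2}) dz`. -/
noncomputable def omega (z : ℂ) : ℂ :=
  Complex.I * (∏ i, (1 - (starRingEnd ℂ) (D.b i) * z) ^ 2) /
    ∏ j, (Complex.exp (-(Complex.I * (D.angle j : ℂ) / 2)) * z -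
      Complex.exp (Complex.I * (D.angle j : ℂ) / 2))

/-- The real differential `Re ((-2g, 1 + g², i (1 - g²)) ω)` at `z`. -/
noncomputable def weierstrassForm (z : ℂ) : ℂ →L[ℝ] R31 :=
  (Complex.reCLM.comp (ContinuousLinearMap.mul ℝ ℂ (-2 * D.gauss z * D.omega z))).prod
    ((Complex.reCLM.comp
        (ContinuousLinearMap.mul ℝ ℂ ((1 + D.gauss z ^ 2) * D.omega z))).prod
      (Complex.reCLM.comp
        (ContinuousLinearMap.mul ℝ ℂ (Complex.I * (1 - D.gauss z ^ 2) * D.omega z))))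

/-- The domain: the plane without the ends `e^{i αⱼ}`, which lie on the unit circle, and without
the poles of `g`. The maxface extends to these poles and to the point at infinity, and is invariant
under `z ↦ 1 / z̄`, so that its image on this domain is its image on the Riemann sphere without the
ends. -/
def domain : Set ℂ :=
  {z | (∀ j, z ≠ Complex.exp (Complex.I * (D.angle j : ℂ))) ∧
    ∀ i, 1 - (starRingEnd ℂ) (D.b i) * z ≠ 0}

/-- `f = Re ∫ (-2g, 1 + g², i (1 - g²)) ω`. -/
def IsMaxface (f : ℂ → R31) : Prop :=
  ∀ z ∈ D.domain, HasFDerivAt f (D.weierstrassForm z) z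

end KobayashiData

/-- Compositions of an isometry of Lorentz-Minkowski space with a homothety. -/
def IsLorentzSimilarity (T : R31 → R31) : Prop :=
  ∃ (L : R31 →ₗ[ℝ] R31) (r : ℝ) (c : R31),
    (∀ u v, lorentz (L u) (L v) = lorentz u v) ∧ r ≠ 0 ∧ ∀ p, T p = r • L p + c

/-- Embedded real-analytic surfaces. -/
def IsAnalyticSurface (S : Set R31) : Prop :=
  ∀ p ∈ S, ∃ (U : Set R31) (Ψ : R31 → ℝ), IsOpen U ∧ p ∈ U ∧ AnalyticOnNhd ℝ Ψ U ∧
    fderiv ℝ Ψ p ≠ 0 ∧ S ∩ U = {q ∈ U | Ψ q = 0}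

/-- `S` is a Kobayashi surface of order `n`: a connected real-analytic surface which, up to
congruence and homothety, is an analytic extension of the maxface given by Kobayashi data of order
`n`. (By connectedness and analyticity, containing the image of the maxface means extending it.) -/
def IsKobayashiSurfaceOfOrder (n : ℕ) (S : Set R31) : Prop :=
  IsConnected S ∧ IsAnalyticSurface S ∧
    ∃ (D : KobayashiData n) (f : ℂ → R31) (T : R31 → R31),
      D.IsMaxface f ∧ IsLorentzSimilarity T ∧ ∀ z ∈ D.domain, T (f z) ∈ S

/-- Kobayashi surfaces. -/
def IsKobayashiSurface (S : Set R31) : Prop :=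
  ∃ n : ℕ, 2 ≤ n ∧ IsKobayashiSurfaceOfOrder n S

end Kobayashi

/-!
Write `u = e^y cos x`, `v = e^y sin x` and `W = √(1 + u²)`. The graph of `t = arcsinh u` has the
slopes `t_x = -v / W` and `t_y = u / W`, so that its metric has determinant `(1 - v²) / W²`, and its
second derivatives are rational in `u`, `v`, `W`; the zero-mean-curvature equation and the absence of
umbilics are then algebraic identities together with `u² + v² = e^{2y} > 0`. The space-like part is
`e^{2y} sin² x < 1`, every point of which can be moved downwards into the half-plane `y < 0`, and
the time-like part `e^{2y} sin² x > 1` is cut into infinitely many pieces by the lines `x ∈ ℤ π`.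

That the graph is not a Kobayashi surface is read off from its Gauss map. The slopes satisfy
`t_x² + t_y² = e^{2y} / W² ≠ 0`, so no tangent plane of the graph is horizontal. On the other hand, the
Gauss map of a Kobayashi surface of order `n ≥ 2` is a Blaschke product of `n - 1 ≥ 1` factors, and
therefore takes every value of the unit disc at some point of the unit disc
(`KobayashiData.exists_gauss_eq`), where the maxface is a conformal space-like immersion
(`KobayashiData.lorentz_weierstrassForm`). Values in the disc correspond to space-like planes
(`exists_gauss_value`), so every space-like plane is parallel to some tangent plane of the
maxface, and this property is stable under similarities: the surface has a horizontal tangent plane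
(`not_isKobayashiSurface_of_no_critical_point`).
-/

/-! ### First and second derivatives of the height function -/

section Scherk

/-- The real part `e^y cos x` of the entire function `e^{y + ix}`. -/
noncomputable def expCos (p : ℝ × ℝ) : ℝ := Real.exp p.2 * Real.cos p.1

/-- The imaginary part `e^y sin x` of the entire function `e^{y + ix}`. -/
noncomputable def expSin (p : ℝ × ℝ) : ℝ := Real.exp p.2 * Real.sin p.1

/-- The height function `t = arcsinh (e^y cos x)`. -/
noncomputable def scherkHeight (p : ℝ × ℝ) : ℝ := Real.arsinh (expCos p)

/-- The factor `√(1 + (e^y cos x)²) = cosh t`, the common denominator of the slopes. -/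
noncomputable def scherkW (p : ℝ × ℝ) : ℝ := √(1 + expCos p ^ 2)

/-- The slope `∂t/∂x`. -/
noncomputable def slopeX (p : ℝ × ℝ) : ℝ := -expSin p * (scherkW p)⁻¹

/-- The slope `∂t/∂y`. -/
noncomputable def slopeY (p : ℝ × ℝ) : ℝ := expCos p * (scherkW p)⁻¹

lemma expCos_sq_add_expSin_sq_pos (p : ℝ × ℝ) : 0 < expCos p ^ 2 + expSin p ^ 2 := by
  have h : expCos p ^ 2 + expSin p ^ 2 = Real.exp p.2 ^ 2 := by
    simp only [expCos, expSin]
    linear_combination Real.exp p.2 ^ 2 * Real.sin_sq_add_cos_sq p.1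
  rw [h]
  positivity

lemma scherkW_pos (p : ℝ × ℝ) : 0 < scherkW p := Real.sqrt_pos.2 (by positivity)

lemma scherkW_sq (p : ℝ × ℝ) : scherkW p ^ 2 = 1 + expCos p ^ 2 := Real.sq_sqrt (by positivity)

lemma hasFDerivAt_expCos (p : ℝ × ℝ) :
    HasFDerivAt expCos (-expSin p • ContinuousLinearMap.fst ℝ ℝ ℝ +
      expCos p • ContinuousLinearMap.snd ℝ ℝ ℝ) p := by
  have h := ((hasFDerivAt_snd (𝕜 := ℝ) (p := p)).exp).mul ((hasFDerivAt_fst (𝕜 := ℝ) (p := p)).cos)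
  refine h.congr_fderiv ?_
  ext <;> simp [expCos, expSin] <;> ring

lemma hasFDerivAt_expSin (p : ℝ × ℝ) :
    HasFDerivAt expSin (expCos p • ContinuousLinearMap.fst ℝ ℝ ℝ +
      expSin p • ContinuousLinearMap.snd ℝ ℝ ℝ) p := by
  have h := ((hasFDerivAt_snd (𝕜 := ℝ) (p := p)).exp).mul ((hasFDerivAt_fst (𝕜 := ℝ) (p := p)).sin)
  refine h.congr_fderiv ?_
  ext <;> simp [expCos, expSin] <;> ring

lemma hasFDerivAt_scherkHeight (p : ℝ × ℝ) :
    HasFDerivAt scherkHeight (slopeX p • ContinuousLinearMap.fst ℝ ℝ ℝ +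
      slopeY p • ContinuousLinearMap.snd ℝ ℝ ℝ) p := by
  refine (hasFDerivAt_expCos p).arsinh.congr_fderiv ?_
  ext <;> simp [slopeX, slopeY, scherkW] <;> ring

lemma hasFDerivAt_scherkW_inv (p : ℝ × ℝ) :
    HasFDerivAt (fun q => (scherkW q)⁻¹) (-(expCos p / scherkW p ^ 3) •
      (-expSin p • ContinuousLinearMap.fst ℝ ℝ ℝ +
        expCos p • ContinuousLinearMap.snd ℝ ℝ ℝ)) p := by
  have hW := (scherkW_pos p).ne'
  have h1 : HasDerivAt (fun s : ℝ => 1 + s ^ 2) (2 * expCos p) (expCos p) := by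
    simpa using (hasDerivAt_pow 2 (expCos p)).const_add 1
  have h2 := ((h1.sqrt (by positivity)).inv hW).comp_hasFDerivAt p (hasFDerivAt_expCos p)
  refine h2.congr_fderiv ?_
  change (-(2 * expCos p / (2 * scherkW p)) / scherkW p ^ 2) • _ = _
  congr 1
  field_simp

lemma hasFDerivAt_slopeX (p : ℝ × ℝ) :
    HasFDerivAt slopeX
      ((-expCos p * (1 + expCos p ^ 2 + expSin p ^ 2) / scherkW p ^ 3) •
          ContinuousLinearMap.fst ℝ ℝ ℝ +
        (-expSin p / scherkW p ^ 3) • ContinuousLinearMap.snd ℝ ℝ ℝ) p := by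
  have hW := (scherkW_pos p).ne'
  refine ((hasFDerivAt_expSin p).neg.mul (hasFDerivAt_scherkW_inv p)).congr_fderiv ?_
  ext
  · simp
    field_simp
    rw [scherkW_sq]
    ring
  · simp
    field_simp
    rw [scherkW_sq]
    ring

lemma hasFDerivAt_slopeY (p : ℝ × ℝ) :
    HasFDerivAt slopeY
      ((-expSin p / scherkW p ^ 3) • ContinuousLinearMap.fst ℝ ℝ ℝ +
        (expCos p / scherkW p ^ 3) • ContinuousLinearMap.snd ℝ ℝ ℝ) p := by
  have hW := (scherkW_pos p).ne'
  refine ((hasFDerivAt_expCos p).mul (hasFDerivAt_scherkW_inv p)).congr_fderiv ?_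
  ext
  · simp
    field_simp
    rw [scherkW_sq]
    ring
  · simp
    field_simp
    rw [scherkW_sq]
    ring

lemma analyticOnNhd_scherkHeight : AnalyticOnNhd ℝ scherkHeight Set.univ := by
  rw [← contDiff_omega_iff_analyticOnNhd]
  unfold scherkHeight expCos
  fun_prop

/-! ### Fundamental forms of the graph -/

lemma partialX_graphMap_scherkHeight :
    partialX (graphMap scherkHeight) = fun p => (slopeX p, 1, 0) := by
  funext p
  have h := (hasFDerivAt_scherkHeight p).prodMk
    ((hasFDerivAt_fst (𝕜 := ℝ) (p := p)).prodMk (hasFDerivAt_snd (𝕜 := ℝ) (p := p)))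
  have h' : fderiv ℝ (graphMap scherkHeight) p = _ := h.fderiv
  simp [partialX, h']

lemma partialY_graphMap_scherkHeight :
    partialY (graphMap scherkHeight) = fun p => (slopeY p, 0, 1) := by
  funext p
  have h := (hasFDerivAt_scherkHeight p).prodMk
    ((hasFDerivAt_fst (𝕜 := ℝ) (p := p)).prodMk (hasFDerivAt_snd (𝕜 := ℝ) (p := p)))
  have h' : fderiv ℝ (graphMap scherkHeight) p = _ := h.fderiv
  simp [partialY, h']

lemma fderiv_prodMk_const {k : ℝ × ℝ → ℝ} {k' : ℝ × ℝ →L[ℝ] ℝ} {p : ℝ × ℝ}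
    (hk : HasFDerivAt k k' p) (c : ℝ × ℝ) (w : ℝ × ℝ) :
    fderiv ℝ (fun q => ((k q, c) : R31)) p w = (k' w, 0, 0) := by
  rw [(hk.prodMk (hasFDerivAt_const c p)).fderiv]
  rfl

lemma metricDet_scherkHeight (p : ℝ × ℝ) :
    metricDet (graphMap scherkHeight) p = (1 - expSin p ^ 2) / scherkW p ^ 2 := by
  have hW := (scherkW_pos p).ne'
  simp only [metricDet, firstE, firstF, firstG, partialX_graphMap_scherkHeight,
    partialY_graphMap_scherkHeight, lorentz, slopeX, slopeY]
  field_simp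
  rw [scherkW_sq]
  ring

/-- The factor normalizing the normal `-(1, ∂t/∂x, ∂t/∂y)` of the graph. -/
noncomputable def normalFactor (p : ℝ × ℝ) : ℝ :=
  (√|lorentz (lorentzCross (partialX (graphMap scherkHeight) p)
      (partialY (graphMap scherkHeight) p))
    (lorentzCross (partialX (graphMap scherkHeight) p)
      (partialY (graphMap scherkHeight) p))|)⁻¹

lemma normalFactor_ne_zero {p : ℝ × ℝ} (hp : metricDet (graphMap scherkHeight) p ≠ 0) :
    normalFactor p ≠ 0 := by
  have h : lorentz (lorentzCross (partialX (graphMap scherkHeight) p)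
      (partialY (graphMap scherkHeight) p))
    (lorentzCross (partialX (graphMap scherkHeight) p)
      (partialY (graphMap scherkHeight) p)) = -metricDet (graphMap scherkHeight) p := by
    simp only [metricDet, firstE, firstF, firstG, lorentz, lorentzCross]
    ring
  rw [normalFactor, h, abs_neg]
  exact inv_ne_zero (Real.sqrt_pos.2 (abs_pos.2 hp)).ne'

lemma fst_unitNormal_scherkHeight (p : ℝ × ℝ) :
    (unitNormal (graphMap scherkHeight) p).1 = -normalFactor p := by
  change normalFactor p * (lorentzCross _ _).1 = _
  simp [partialX_graphMap_scherkHeight, partialY_graphMap_scherkHeight, lorentzCross]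

lemma secondL_scherkHeight (p : ℝ × ℝ) :
    secondL (graphMap scherkHeight) p =
      normalFactor p * (-expCos p * (1 + expCos p ^ 2 + expSin p ^ 2) / scherkW p ^ 3) := by
  have h := fderiv_prodMk_const (hasFDerivAt_slopeX p) (1, 0) (1, 0)
  rw [secondL, partialX_graphMap_scherkHeight, partialX, h, lorentz, fst_unitNormal_scherkHeight]
  simp
  ring

lemma secondM_scherkHeight (p : ℝ × ℝ) :
    secondM (graphMap scherkHeight) p = normalFactor p * (-expSin p / scherkW p ^ 3) := by
  have h := fderiv_prodMk_const (hasFDerivAt_slopeY p) (0, 1) (1, 0)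
  rw [secondM, partialY_graphMap_scherkHeight, partialX, h, lorentz, fst_unitNormal_scherkHeight]
  simp
  ring

lemma secondN_scherkHeight (p : ℝ × ℝ) :
    secondN (graphMap scherkHeight) p = normalFactor p * (expCos p / scherkW p ^ 3) := by
  have h := fderiv_prodMk_const (hasFDerivAt_slopeY p) (0, 1) (0, 1)
  rw [secondN, partialY_graphMap_scherkHeight, partialY, h, lorentz, fst_unitNormal_scherkHeight]
  simp
  ring

/-- The zero-mean-curvature equation, without the division by the metric determinant. -/
lemma zmc_numerator_scherkHeight (p : ℝ × ℝ) :
    firstG (graphMap scherkHeight) p * secondL (graphMap scherkHeight) p -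
      2 * (firstF (graphMap scherkHeight) p * secondM (graphMap scherkHeight) p) +
      firstE (graphMap scherkHeight) p * secondN (graphMap scherkHeight) p = 0 := by
  have hW := (scherkW_pos p).ne'
  rw [secondL_scherkHeight, secondM_scherkHeight, secondN_scherkHeight]
  simp only [firstE, firstF, firstG, partialX_graphMap_scherkHeight,
    partialY_graphMap_scherkHeight, lorentz, slopeX, slopeY]
  field_simp
  rw [scherkW_sq]
  ring

lemma isEntireZMCGraphTypeS_scherkHeight : IsEntireZMCGraphTypeS scherkHeight where
  analytic := analyticOnNhd_scherkHeight
  zmc p _ := by rw [meanCurvature, zmc_numerator_scherkHeight, zero_div]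

/-- At an umbilic of a zero-mean-curvature surface the second fundamental form vanishes, whereas
`∂²t/∂x∂y` and `∂²t/∂y²` have no common zero. -/
lemma not_isUmbilic_scherkHeight (p : ℝ × ℝ) : ¬ IsUmbilic (graphMap scherkHeight) p := by
  rintro ⟨hdet, k, hL, hM, hN⟩
  have hzmc := zmc_numerator_scherkHeight p
  have hk : k = 0 := by
    have h : k * metricDet (graphMap scherkHeight) p = 0 := by
      rw [hL, hM, hN] at hzmc
      rw [metricDet]
      linear_combination hzmc / 2
    exact (mul_eq_zero.1 h).resolve_right hdet
  have hW := (scherkW_pos p).ne'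
  have hc := normalFactor_ne_zero hdet
  rw [secondM_scherkHeight, hk, zero_mul] at hM
  rw [secondN_scherkHeight, hk, zero_mul] at hN
  have hv : expSin p = 0 := by simpa [hc, hW] using hM
  have hu : expCos p = 0 := by simpa [hc, hW] using hN
  have := expCos_sq_add_expSin_sq_pos p
  simp [hu, hv] at this

/-! ### Space-like and time-like parts -/

lemma spacelikeSet_scherkHeight :
    spacelikeSet (graphMap scherkHeight) = {p | expSin p ^ 2 < 1} := by
  ext p
  have hW := scherkW_pos p
  rw [spacelikeSet, Set.mem_ofPred_eq, metricDet_scherkHeight, div_pos_iff_of_pos_right (by positivity),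
    sub_pos, Set.mem_ofPred_eq]

lemma timelikeSet_scherkHeight :
    timelikeSet (graphMap scherkHeight) = {p | 1 < expSin p ^ 2} := by
  ext p
  have hW := scherkW_pos p
  rw [timelikeSet, Set.mem_ofPred_eq, metricDet_scherkHeight, div_neg_iff]
  simp only [Set.mem_ofPred_eq, sub_neg]
  constructor
  · rintro (⟨_, h⟩ | ⟨h, _⟩)
    · exact absurd h (not_lt.2 (by positivity))
    · exact h
  · exact fun h => Or.inr ⟨h, by positivity⟩

/-- The space-like part is the region `e^{2y} sin² x < 1`, each point of which can be moved
downwards to the half-plane `y < 0`. -/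
lemma isConnected_spacelikeSet_scherkHeight :
    IsConnected (spacelikeSet (graphMap scherkHeight)) := by
  rw [spacelikeSet_scherkHeight]
  refine IsPathConnected.isConnected ⟨(0, 0), by simp [expSin], ?_⟩
  rintro ⟨x, y⟩ hxy
  have hlow : JoinedIn {p | expSin p ^ 2 < 1} ((0, 0) : ℝ × ℝ) (0, -1) :=
    JoinedIn.of_segment_subset fun q hq => by
      rw [segment_eq_image_lineMap] at hq
      obtain ⟨s, -, rfl⟩ := hq
      simp [AffineMap.lineMap_apply, expSin]
  have hmid : JoinedIn {p | expSin p ^ 2 < 1} ((0, -1) : ℝ × ℝ) (x, min y (-1)) :=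
    JoinedIn.of_segment_subset fun q hq => by
      have hconv : Convex ℝ {q : ℝ × ℝ | q.2 ≤ -1} :=
        convex_halfSpace_le (ContinuousLinearMap.snd ℝ ℝ ℝ).isBoundedLinearMap.toIsLinearMap (-1)
      have hq' : q.2 ≤ -1 := hconv.segment_subset (by simp) (by simp) hq
      have h1 : Real.exp q.2 < 1 := Real.exp_lt_one_iff.mpr (by linarith)
      have h2 := Real.sin_sq_le_one q.1
      have h3 := Real.exp_pos q.2
      change (Real.exp q.2 * Real.sin q.1) ^ 2 < 1
      rw [mul_pow]
      nlinarith [sq_nonneg (Real.sin q.1)]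
  have hup : JoinedIn {p | expSin p ^ 2 < 1} ((x, min y (-1)) : ℝ × ℝ) (x, y) :=
    JoinedIn.of_segment_subset fun q hq => by
      have hconv : Convex ℝ {q : ℝ × ℝ | q.2 ≤ y} :=
        convex_halfSpace_le (ContinuousLinearMap.snd ℝ ℝ ℝ).isBoundedLinearMap.toIsLinearMap y
      have hq2 : q.2 ≤ y := hconv.segment_subset (by simp) (by simp) hq
      have hq1 : q.1 = x := by
        rw [segment_eq_image_lineMap] at hq
        obtain ⟨s, -, rfl⟩ := hq
        simp [AffineMap.lineMap_apply]
      have hxy' : expSin (x, y) ^ 2 < 1 := hxy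
      refine lt_of_le_of_lt (b := expSin (x, y) ^ 2) ?_ hxy'
      simp only [expSin, mul_pow, hq1]
      gcongr
  exact (hlow.trans hmid).trans hup

/-- The vertical lines `x ∈ ℤ π` separate the time-like part `e^{2y} sin² x > 1` into infinitely
many pieces. -/
lemma infinite_componentsOf_timelikeSet_scherkHeight :
    (componentsOf (timelikeSet (graphMap scherkHeight))).Infinite := by
  rw [timelikeSet_scherkHeight]
  set A : Set (ℝ × ℝ) := {p | 1 < expSin p ^ 2} with hA
  let P : ℕ → ℝ × ℝ := fun k => (Real.pi / 2 + k * Real.pi, 1)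
  have hP : ∀ k, P k ∈ A := fun k => by
    have h1 : Real.sin (Real.pi / 2 + k * Real.pi) ^ 2 = 1 := by
      rw [Real.sin_add_nat_mul_pi, Real.sin_pi_div_two, mul_one, ← pow_mul, mul_comm, pow_mul]
      simp
    have h2 : 1 < Real.exp 1 := Real.one_lt_exp_iff.2 one_pos
    change 1 < (Real.exp 1 * Real.sin (Real.pi / 2 + k * Real.pi)) ^ 2
    rw [mul_pow, h1]
    nlinarith
  have hsep : ∀ j k : ℕ, j < k → connectedComponentIn A (P j) ≠ connectedComponentIn A (P k) := by
    intro j k hjk heq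
    have hC : IsPreconnected (Prod.fst '' connectedComponentIn A (P j)) :=
      isPreconnected_connectedComponentIn.image _ continuous_fst.continuousOn
    have hj : (P j).1 ∈ Prod.fst '' connectedComponentIn A (P j) :=
      Set.mem_image_of_mem _ (mem_connectedComponentIn (hP j))
    have hk : (P k).1 ∈ Prod.fst '' connectedComponentIn A (P j) :=
      Set.mem_image_of_mem _ (heq ▸ mem_connectedComponentIn (hP k))
    have hjk' : (j : ℝ) + 1 ≤ k := by exact_mod_cast hjk
    have hpi := Real.pi_pos
    have hmem : ((j + 1 : ℕ) : ℝ) * Real.pi ∈ Set.Icc (P j).1 (P k).1 := by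
      simp only [P, Set.mem_Icc]
      push_cast
      constructor <;> nlinarith
    obtain ⟨q, hq, hq1⟩ := hC.Icc_subset hj hk hmem
    have hqA : 1 < expSin q ^ 2 := connectedComponentIn_subset A (P j) hq
    rw [expSin, hq1, Real.sin_nat_mul_pi] at hqA
    norm_num at hqA
  have hinj : Function.Injective fun k => connectedComponentIn A (P k) := fun j k hjk => by
    rcases lt_trichotomy j k with h | h | h
    · exact absurd hjk (hsep j k h)
    · exact h
    · exact absurd hjk.symm (hsep k j h)
  exact Set.infinite_of_injective_forall_mem hinj fun k => ⟨P k, hP k, rfl⟩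

lemma isMixedType_scherkHeight : IsMixedType (graphMap scherkHeight) := by
  refine ⟨isConnected_spacelikeSet_scherkHeight.nonempty, ?_⟩
  obtain ⟨_, p, hp, -⟩ := infinite_componentsOf_timelikeSet_scherkHeight.nonempty
  exact ⟨p, hp⟩

end Scherk

/-! ### Blaschke products and the Weierstrass data in the unit disc -/

section Disc

open ComplexConjugate

lemma normSq_sub_sub_normSq_one_sub (b z : ℂ) :
    Complex.normSq (z - b) - Complex.normSq (1 - conj b * z) =
      (Complex.normSq z - 1) * (1 - Complex.normSq b) := by
  simp only [Complex.normSq_apply, Complex.sub_re, Complex.sub_im, Complex.mul_re, Complex.mul_im,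
    Complex.conj_re, Complex.conj_im, Complex.one_re, Complex.one_im]
  ring

lemma norm_one_sub_conj_mul_le {b z : ℂ} (hb : ‖b‖ < 1) (hz : 1 ≤ ‖z‖) :
    ‖1 - conj b * z‖ ≤ ‖z - b‖ := by
  have h := normSq_sub_sub_normSq_one_sub b z
  simp only [Complex.normSq_eq_norm_sq] at h
  have h0 := norm_nonneg b
  have h1 : 0 ≤ (‖z‖ ^ 2 - 1) * (1 - ‖b‖ ^ 2) := mul_nonneg (by nlinarith) (by nlinarith)
  exact abs_le_of_sq_le_sq' (by linarith) (norm_nonneg _) |>.2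

lemma one_sub_conj_mul_ne_zero {b z : ℂ} (hb : ‖b‖ < 1) (hz : ‖z‖ < 1) : 1 - conj b * z ≠ 0 := by
  intro h
  have h1 : ‖conj b * z‖ = 1 := by rw [← sub_eq_zero.1 h, norm_one]
  rw [norm_mul, RCLike.norm_conj] at h1
  nlinarith [norm_nonneg b, norm_nonneg z]

/-- The equation `∏ (z - bᵢ) = w ∏ (1 - b̄ᵢ z)` is polynomial, and its leading coefficient
`1 - w ∏ (-b̄ᵢ)` does not vanish. -/
lemma exists_prod_sub_eq {m : ℕ} (hm : m ≠ 0) {b : Fin m → ℂ} (hb : ∀ i, ‖b i‖ < 1) {w : ℂ}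
    (hw : ‖w‖ < 1) : ∃ z : ℂ, ∏ i, (z - b i) = w * ∏ i, (1 - conj (b i) * z) := by
  open Polynomial in
  let p : ℂ[X] := ∏ i, (X - C (b i)) - C w * ∏ i, (1 - C (conj (b i)) * X)
  have hcoeff : p.coeff m = 1 - w * ∏ i, -conj (b i) := by
    have h1 : (∏ i, (Polynomial.X - Polynomial.C (b i))).coeff m = 1 := by
      have h := Polynomial.coeff_prod_of_natDegree_le Finset.univ
        (fun i => Polynomial.X - Polynomial.C (b i)) 1 fun i _ => by compute_degree
      simpa [Polynomial.coeff_X, Polynomial.coeff_C] using h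
    have h2 : (∏ i, (1 - Polynomial.C (conj (b i)) * Polynomial.X)).coeff m =
        ∏ i, -conj (b i) := by
      have h := Polynomial.coeff_prod_of_natDegree_le Finset.univ
        (fun i => 1 - Polynomial.C (conj (b i)) * Polynomial.X) 1 fun i _ => by compute_degree
      simpa [Polynomial.coeff_one] using h
    rw [Polynomial.coeff_sub, Polynomial.coeff_C_mul, h1, h2]
  have hne : p.coeff m ≠ 0 := by
    rw [hcoeff, sub_ne_zero]
    intro h
    have h1 : ‖w * ∏ i, -conj (b i)‖ = 1 := by rw [← h, norm_one]
    have h2 : ∏ i, ‖-conj (b i)‖ ≤ 1 := Finset.prod_le_one (fun _ _ => norm_nonneg _) fun i _ => by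
      rw [norm_neg, RCLike.norm_conj]
      exact (hb i).le
    rw [norm_mul, norm_prod] at h1
    nlinarith [norm_nonneg w]
  have hdeg : p.degree ≠ 0 := fun h =>
    hne (Polynomial.coeff_eq_zero_of_degree_lt (by rw [h]; exact_mod_cast Nat.pos_of_ne_zero hm))
  obtain ⟨z, hz⟩ := IsAlgClosed.exists_root p hdeg
  refine ⟨z, sub_eq_zero.1 ?_⟩
  simpa [p, Polynomial.IsRoot, Polynomial.eval_prod] using hz

/-- The roots of `∏ (z - bᵢ) = w ∏ (1 - b̄ᵢ z)` lie in the unit disc, since each factor on the left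
dominates its counterpart on the right outside the disc. -/
lemma norm_lt_one_of_prod_sub_eq {m : ℕ} {b : Fin m → ℂ} (hb : ∀ i, ‖b i‖ < 1) {w z : ℂ}
    (hw : ‖w‖ < 1) (h : ∏ i, (z - b i) = w * ∏ i, (1 - conj (b i) * z)) : ‖z‖ < 1 := by
  by_contra! hz
  have hle : ∏ i, ‖1 - conj (b i) * z‖ ≤ ∏ i, ‖z - b i‖ :=
    Finset.prod_le_prod (fun _ _ => norm_nonneg _) fun i _ => norm_one_sub_conj_mul_le (hb i) hz
  have hpos : 0 < ∏ i, ‖z - b i‖ := Finset.prod_pos fun i _ =>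
    norm_pos_iff.2 <| sub_ne_zero.2 fun hzb => absurd (hb i) (by rw [← hzb]; exact not_lt.2 hz)
  have heq := congrArg norm h
  rw [norm_mul, norm_prod, norm_prod] at heq
  nlinarith [norm_nonneg w]

end Disc

namespace KobayashiData

variable {n : ℕ} (D : KobayashiData n)

lemma mem_domain_of_norm_lt_one {z : ℂ} (hz : ‖z‖ < 1) : z ∈ D.domain := by
  refine ⟨fun j h => ?_, fun i => one_sub_conj_mul_ne_zero (D.norm_b_lt i) hz⟩
  rw [h, mul_comm, Complex.norm_exp_ofReal_mul_I] at hz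
  exact lt_irrefl _ hz

/-- For order at least two the Gauss map is a nonconstant Blaschke product, which takes every value
of the unit disc at a point of the unit disc. -/
lemma exists_gauss_eq (hn : 2 ≤ n) {w : ℂ} (hw : ‖w‖ < 1) : ∃ z : ℂ, ‖z‖ < 1 ∧ D.gauss z = w := by
  obtain ⟨z, hz⟩ := exists_prod_sub_eq (by omega : n - 1 ≠ 0) D.norm_b_lt hw
  have hz1 := norm_lt_one_of_prod_sub_eq D.norm_b_lt hw hz
  refine ⟨z, hz1, ?_⟩
  rw [gauss, Finset.prod_div_distrib, div_eq_iff, hz]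
  exact Finset.prod_ne_zero_iff.2 fun i _ => one_sub_conj_mul_ne_zero (D.norm_b_lt i) hz1

lemma omega_ne_zero {z : ℂ} (hz : ‖z‖ < 1) : D.omega z ≠ 0 := by
  refine div_ne_zero (mul_ne_zero Complex.I_ne_zero ?_) ?_
  · exact Finset.prod_ne_zero_iff.2 fun i _ =>
      pow_ne_zero 2 (one_sub_conj_mul_ne_zero (D.norm_b_lt i) hz)
  · refine Finset.prod_ne_zero_iff.2 fun j _ => sub_ne_zero.2 fun h => hz.ne ?_
    have h1 : Complex.I * (D.angle j : ℂ) / 2 = ((D.angle j / 2 : ℝ) : ℂ) * Complex.I := by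
      push_cast
      ring
    have h2 : -(((D.angle j / 2 : ℝ) : ℂ) * Complex.I) = ((-(D.angle j / 2) : ℝ) : ℂ) * Complex.I := by
      push_cast
      ring
    have h3 := congrArg norm h
    rwa [h1, h2, norm_mul, Complex.norm_exp_ofReal_mul_I, Complex.norm_exp_ofReal_mul_I,
      one_mul] at h3

lemma weierstrassForm_apply (z v : ℂ) :
    D.weierstrassForm z v = ((-2 * D.gauss z * D.omega z * v).re,
      ((1 + D.gauss z ^ 2) * D.omega z * v).re,
      (Complex.I * (1 - D.gauss z ^ 2) * D.omega z * v).re) := rfl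

/-- The maxface is conformal, with factor `(1 - |g|²)² |ω|²`; this is the polarized form. -/
lemma lorentz_weierstrassForm (z v v' : ℂ) :
    lorentz (D.weierstrassForm z v) (D.weierstrassForm z v') =
      (1 - Complex.normSq (D.gauss z)) ^ 2 * Complex.normSq (D.omega z) *
        (v.re * v'.re + v.im * v'.im) := by
  simp only [weierstrassForm_apply, lorentz, Complex.normSq_apply, pow_two, Complex.mul_re,
    Complex.mul_im, Complex.add_re, Complex.add_im, Complex.sub_re, Complex.sub_im, Complex.one_re,
    Complex.one_im, Complex.I_re, Complex.I_im, Complex.neg_re, Complex.neg_im, Complex.re_ofNat,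
    Complex.im_ofNat]
  ring

end KobayashiData

/-! ### Lorentz isometries and space-like planes -/

lemma injective_of_lorentz_eq {L : R31 →ₗ[ℝ] R31}
    (hL : ∀ u v, lorentz (L u) (L v) = lorentz u v) : Function.Injective L := by
  rw [injective_iff_map_eq_zero]
  intro u hu
  have h : ∀ v, lorentz u v = 0 := fun v => by rw [← hL, hu]; simp [lorentz]
  have h1 := h (1, 0, 0)
  have h2 := h (0, 1, 0)
  have h3 := h (0, 0, 1)
  simp only [lorentz] at h1 h2 h3
  ext
  · simpa using h1
  · simpa using h2
  · simpa using h3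

/-- The first coordinate of `L v` is the inner product of `v` with the time-like unit vector
`-L⁻¹ (1, 0, 0)`. -/
lemma exists_fst_eq_of_lorentz_eq {L : R31 →ₗ[ℝ] R31}
    (hL : ∀ u v, lorentz (L u) (L v) = lorentz u v) :
    ∃ m : R31, m.1 ^ 2 = 1 + m.2.1 ^ 2 + m.2.2 ^ 2 ∧ ∀ v, (L v).1 = lorentz m v := by
  obtain ⟨m, hm⟩ := LinearMap.surjective_of_injective (injective_of_lorentz_eq hL) (-1, 0, 0)
  refine ⟨m, ?_, fun v => ?_⟩
  · have h := hL m m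
    rw [hm] at h
    simp only [lorentz] at h
    linarith
  · rw [← hL, hm]
    simp [lorentz]

/-- Each time-like unit vector `m` is orthogonal to the null direction
`(-2w, 1 + w², i (1 - w²))` for some `w` in the unit disc, given by stereographic projection
of the hyperboloid. -/
lemma exists_gauss_value {m : R31} (hm : m.1 ^ 2 = 1 + m.2.1 ^ 2 + m.2.2 ^ 2) :
    ∃ w : ℂ, ‖w‖ < 1 ∧
      2 * m.1 * w + m.2.1 * (1 + w ^ 2) + m.2.2 * (Complex.I * (1 - w ^ 2)) = 0 := by
  obtain ⟨a, b, c⟩ := m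
  simp only at hm ⊢
  -- The root of smaller modulus of `(b - ic) w² + 2 a w + (b + ic) = 0` is
  -- `-(b + ic) / (a + s)`, where `s` is the sign of `a`.
  obtain ⟨s, hs2, hs⟩ : ∃ s : ℝ, s ^ 2 = 1 ∧ 0 < s * a := by
    have ha : a ≠ 0 := by
      rintro rfl
      nlinarith [sq_nonneg b, sq_nonneg c]
    rcases ha.lt_or_gt with h | h
    · exact ⟨-1, by norm_num, by linarith⟩
    · exact ⟨1, by norm_num, by linarith⟩
  have hne : a + s ≠ 0 := by
    intro h
    have : a = -s := by linarith
    rw [this] at hs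
    nlinarith
  have hpos : 0 < (a + s) ^ 2 := by positivity
  refine ⟨-(b + c * Complex.I) / ((a + s : ℝ) : ℂ), ?_, ?_⟩
  · have h1 : ‖-(b + c * Complex.I) / ((a + s : ℝ) : ℂ)‖ ^ 2 < 1 := by
      rw [← Complex.normSq_eq_norm_sq, Complex.normSq_div, Complex.normSq_neg,
        Complex.normSq_add_mul_I, Complex.normSq_ofReal, div_lt_one (by nlinarith)]
      nlinarith
    exact (sq_lt_one_iff₀ (norm_nonneg _)).1 h1
  · have hneC : ((a + s : ℝ) : ℂ) ≠ 0 := by exact_mod_cast hne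
    have hmC : (a : ℂ) ^ 2 = 1 + (b : ℂ) ^ 2 + (c : ℂ) ^ 2 := by exact_mod_cast hm
    have hsC : (s : ℂ) ^ 2 = 1 := by exact_mod_cast hs2
    field_simp
    push_cast
    linear_combination (b + c * Complex.I : ℂ) * (hsC - hmC) -
      (b * c ^ 2 + c ^ 3 * Complex.I : ℂ) * Complex.I_sq

/-- Two vectors of a horizontal plane that are annihilated by a nonzero covector are parallel, hence
cannot be orthogonal and space-like. -/
lemma eq_zero_of_orthogonal_of_annihilated {A B : R31} (hA0 : A.1 = 0) (hB0 : B.1 = 0)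
    (hAB : lorentz A B = 0) (hA : 0 < lorentz A A) (hB : 0 < lorentz B B) {p q : ℝ}
    (hpA : p * A.2.1 + q * A.2.2 = 0) (hpB : p * B.2.1 + q * B.2.2 = 0) : p = 0 ∧ q = 0 := by
  obtain ⟨_, a, b⟩ := A
  obtain ⟨_, c, d⟩ := B
  simp only [lorentz] at *
  subst hA0 hB0
  have hdet : a * d - b * c ≠ 0 := by
    intro h
    have h1 : (a * a + b * b) * (c * c + d * d) = 0 := by
      linear_combination (a * d - b * c) * h + (a * c + b * d) * hAB
    have h2 : 0 < (a * a + b * b) * (c * c + d * d) := mul_pos (by linarith) (by linarith)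
    exact h2.ne' h1
  constructor
  · refine (mul_eq_zero.1 (?_ : (a * d - b * c) * p = 0)).resolve_left hdet
    linear_combination d * hpA - b * hpB
  · refine (mul_eq_zero.1 (?_ : (a * d - b * c) * q = 0)).resolve_left hdet
    linear_combination a * hpB - c * hpA

/-! ### Graphs without horizontal tangent planes -/

/-- A Kobayashi surface has a horizontal tangent plane: no graph `t = h (x, y)` without critical
points is one. -/
lemma not_isKobayashiSurface_of_no_critical_point {h : ℝ × ℝ → ℝ} {hx hy : ℝ × ℝ → ℝ}
    (hh : ∀ p, HasFDerivAt h (hx p • ContinuousLinearMap.fst ℝ ℝ ℝ +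
      hy p • ContinuousLinearMap.snd ℝ ℝ ℝ) p)
    (hcrit : ∀ p, ¬ (hx p = 0 ∧ hy p = 0)) : ¬ IsKobayashiSurface (Set.range (graphMap h)) := by
  rintro ⟨n, hn, -, -, D, f, T, hf, ⟨L, r, c, hL, hr, hT⟩, hS⟩
  obtain ⟨m, hm, hLm⟩ := exists_fst_eq_of_lorentz_eq hL
  obtain ⟨w, hw, hwm⟩ := exists_gauss_value hm
  obtain ⟨z, hz, hgz⟩ := D.exists_gauss_eq hn hw
  have hω := D.omega_ne_zero hz
  -- By the choice of `w`, the image of the tangent plane at `z` under `L` is horizontal.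
  have hfst : ∀ v, (L (D.weierstrassForm z v)).1 = 0 := fun v => by
    have hre := congrArg (fun u : ℂ => (u * (D.omega z * v)).re) hwm
    rw [hLm, D.weierstrassForm_apply, hgz]
    simp only [lorentz]
    rw [← Complex.re_ofReal_mul, ← Complex.re_ofReal_mul, ← Complex.re_ofReal_mul, ← Complex.neg_re,
      ← Complex.add_re, ← Complex.add_re]
    simp only [zero_mul, Complex.zero_re] at hre
    rw [← hre]
    congr 1
    ring
  have hfac : 0 < (1 - Complex.normSq (D.gauss z)) ^ 2 * Complex.normSq (D.omega z) := by
    have h1 : Complex.normSq (D.gauss z) < 1 := by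
      rw [hgz, Complex.normSq_eq_norm_sq]
      exact (sq_lt_one_iff₀ (norm_nonneg _)).2 hw
    have h2 := Complex.normSq_pos.2 hω
    have h3 : 0 < 1 - Complex.normSq (D.gauss z) := by linarith
    positivity
  set q : ℝ × ℝ := (T (f z)).2 with hq
  -- Differentiating `t = h (x, y)` along `T ∘ f`.
  have hderiv : HasFDerivAt (fun ζ => T (f ζ))
      (r • L.toContinuousLinearMap.comp (D.weierstrassForm z)) z := by
    have h1 := ((L.toContinuousLinearMap.hasFDerivAt.comp z
      (hf z (D.mem_domain_of_norm_lt_one hz))).const_smul r).add_const c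
    exact h1.congr_of_eventuallyEq (Filter.Eventually.of_forall fun ζ => hT (f ζ))
  have hgraph : (fun ζ => (T (f ζ)).1) =ᶠ[nhds z] fun ζ => h (T (f ζ)).2 := by
    have hball : ∀ᶠ ζ : ℂ in nhds z, ‖ζ‖ < 1 := continuous_norm.continuousAt.eventually_lt_const hz
    filter_upwards [hball] with ζ hζ
    obtain ⟨p, hp⟩ := hS ζ (D.mem_domain_of_norm_lt_one hζ)
    rw [← hp]
    rfl
  have htan := ((hh q).comp z hderiv.snd).unique (hderiv.fst.congr_of_eventuallyEq hgraph.symm)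
  have hann : ∀ v, hx q * (L (D.weierstrassForm z v)).2.1 +
      hy q * (L (D.weierstrassForm z v)).2.2 = 0 := fun v => by
    have h1 := congrArg (fun ℓ : ℂ →L[ℝ] ℝ => ℓ v) htan
    simp [hfst] at h1
    refine (mul_eq_zero.1 (?_ : r * _ = 0)).resolve_left hr
    linear_combination h1
  refine hcrit q (eq_zero_of_orthogonal_of_annihilated (hfst 1) (hfst Complex.I) ?_ ?_ ?_
    (hann 1) (hann Complex.I))
  · rw [hL, D.lorentz_weierstrassForm]
    simp
  · rw [hL, D.lorentz_weierstrassForm]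
    simpa using hfac
  · rw [hL, D.lorentz_weierstrassForm]
    simpa using hfac

theorem theorem1 :
    ∃ h : ℝ × ℝ → ℝ,
      (∀ x y : ℝ, h (x, y) = Real.arsinh (Real.exp y * Real.cos x)) ∧
      IsEntireZMCGraphTypeS h ∧
      IsMixedType (graphMap h) ∧
      IsConnected (spacelikeSet (graphMap h)) ∧
      (componentsOf (timelikeSet (graphMap h))).Infinite ∧
      (∀ p : ℝ × ℝ, ¬ IsUmbilic (graphMap h) p) ∧
      ¬ IsKobayashiSurface (Set.range (graphMap h)) := by
  refine ⟨scherkHeight, fun _ _ => rfl, isEntireZMCGraphTypeS_scherkHeight, isMixedType_scherkHeight,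
    isConnected_spacelikeSet_scherkHeight, infinite_componentsOf_timelikeSet_scherkHeight,
    not_isUmbilic_scherkHeight,
    not_isKobayashiSurface_of_no_critical_point hasFDerivAt_scherkHeight ?_⟩
  rintro p ⟨hX, hY⟩
  have hW := (scherkW_pos p).ne'
  have hv : expSin p = 0 := by simpa [slopeX, hW] using hX
  have hu : expCos p = 0 := by simpa [slopeY, hW] using hY
  have := expCos_sq_add_expSin_sq_pos p
  simp [hu, hv] at this
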